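/- All graphs are finite and simple. For a proper coloring of a graph $G$, a vertex is a b-vertex if it has a neighbor in every color class other than its own; the coloring is a b-coloring if every color class is nonempty and contains a b-vertex. The b-spectrum $S_b(G)$ is the set of positive integers $k$ such that $G$ has a b-coloring with exactly $k$ colors, $\chi_b(G)=\max S_b(G)$ is the b-chromatic number (with $\chi_b(G)=0$ if $G$ has no vertices), and $G$ is b-continuous if $S_b(G)$ contains every integer in the closed interval $[\chi(G),\chi_b(G)]$, where $\chi$ is the chromatic number. The lexicographic product $G[H]$ has vertex set $V(G)\times V(H)$, with $(x,y)$ and $(x',y')$ adjacent if and only if either $x=x'$ and $yy'\in E(H)$, or $xx'\in E(G)$. A graph is chordal if every cycle of length at least four has a chord. Let $G$ be a chordal graph with at least one vertex and let $H$ be a b-continuous graph. Put $t=\chi_b(H)$, and let $K_t$ be the complete graph on $t$ vertices. Then every integer $k$ with $\chi(G[H])\le k\le \chi_b(G[K_t])$ belongs to $S_b(G[H])$, that is, $$[\chi(G[H]),\chi_b(G[K_t])]\subseteq S_b(G[H]).$$ -/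

import Mathlib

namespace SimpleGraph

/-- A vertex `v` is a b-vertex of the proper coloring `C` if it has a neighbor in every
color class other than its own. -/
def Coloring.IsBVertex {V α : Type*} {G : SimpleGraph V} (C : G.Coloring α) (v : V) : Prop :=
  ∀ j : α, j ≠ C v → ∃ w, G.Adj v w ∧ C w = j

/-- A proper coloring is a b-coloring if every color class contains a b-vertex
(in particular every color is used). -/
def Coloring.IsBColoring {V α : Type*} {G : SimpleGraph V} (C : G.Coloring α) : Prop :=
  ∀ i : α, ∃ v, C v = i ∧ C.IsBVertex v

/-- The b-spectrum `S_b(G)`: all positive `k` such that `G` has a b-coloring with `k` colors. -/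
def bSpectrum {V : Type*} (G : SimpleGraph V) : Set ℕ :=
  {k | 0 < k ∧ ∃ C : G.Coloring (Fin k), C.IsBColoring}

/-- The b-spectrum of a finite graph is bounded by its number of vertices. -/
theorem bSpectrum_bddAbove {V : Type*} [Finite V] (G : SimpleGraph V) :
    BddAbove G.bSpectrum := by
  refine ⟨Nat.card V, ?_⟩
  rintro k ⟨-, C, hC⟩
  have h : Function.Surjective C := fun i => ⟨(hC i).choose, (hC i).choose_spec.1⟩
  simpa using Nat.card_le_card_of_surjective C h

/-- The b-chromatic number `χ_b(G)`: the largest `k` such that `G` has a b-coloring with `k`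
colors. -/
noncomputable def bChromaticNumber {V : Type*} (G : SimpleGraph V) : ℕ :=
  sSup G.bSpectrum

/-- `G` is b-continuous if `S_b(G)` contains every integer in `[χ(G), χ_b(G)]`. -/
def IsBContinuous {V : Type*} (G : SimpleGraph V) : Prop :=
  ∀ k : ℕ, G.chromaticNumber ≤ (k : ℕ∞) → k ≤ G.bChromaticNumber → k ∈ G.bSpectrum

/-- `G` is chordal if every cycle of length at least four has a chord. -/
def IsChordal {V : Type*} (G : SimpleGraph V) : Prop :=
  ∀ (v : V) (p : G.Walk v v), p.IsCycle → 4 ≤ p.length → ∃ e : Sym2 V, p.IsChord e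

/-- The lexicographic product `G[H]`. -/
def lexProd {V W : Type*} (G : SimpleGraph V) (H : SimpleGraph W) : SimpleGraph (V × W) where
  Adj p q := (p.1 = q.1 ∧ H.Adj p.2 q.2) ∨ G.Adj p.1 q.1
  symm := ⟨by
    rintro p q (⟨h₁, h₂⟩ | h)
    · exact Or.inl ⟨h₁.symm, h₂.symm⟩
    · exact Or.inr h.symm⟩
  loopless := ⟨by
    rintro p (⟨_, h⟩ | h)
    · exact H.loopless.irrefl _ h
    · exact G.loopless.irrefl _ h⟩

end SimpleGraph

/-! Write ω for the clique number of G, h = χ(H) and t = χ_b(H). The interval is cut at ωt. A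
chordal graph is ω-colorable, and the fibres of G[H] over a maximum clique use pairwise disjoint
sets of at least h colours, so k ≥ χ(G[H]) forces k ≥ ωh. For k ≤ ωt, write k as a sum of ω numbers
between h and t, give each colour class of G a palette of the corresponding size, and put a
b-coloring of H on every fibre; such b-colorings exist because H is b-continuous. A maximum clique
of G meets every class, so its fibres supply all the b-vertices (`lexProd_mem_bSpectrum_of_le_mul`).
For k ≥ ωt, replacing each clique fibre of G[K_t] by a b-coloring of H with t colours reduces the
claim to G[K_t] (`lexProd_bSpectrum_subset`). Every nonempty induced subgraph of G[K_t] has a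
simplicial vertex, as for G, and its cliques have at most ωt vertices. Deleting a simplicial vertex
loses at most one colour of a b-coloring (`IsBColoringOn.exists_erase`). Hence deletion from an
optimal b-coloring meets every k ≥ ωt on the way down, and the deleted vertices have few enough
neighbours to be put back greedily. -/

namespace SimpleGraph

/-! ### Simplicial vertices: Dirac's theorem and blow-ups by cliques -/

/-- If `y` and `z` are neighbours of `x` joined by a walk whose interior avoids the closed
neighbourhood of `x`, then `y` and `z` are adjacent in a chordal graph. -/
theorem IsChordal.adj_of_walk {V : Type*} {G : SimpleGraph V} (hG : G.IsChordal) {x y z : V}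
    {T : Set V} (hxy : G.Adj x y) (hxz : G.Adj x z) (hT : ∀ v ∈ T, ¬ G.Adj x v) (hxT : x ∉ T)
    (hyz : y ≠ z) (hp : ∃ p : G.Walk y z, ∀ v ∈ p.support, v = y ∨ v = z ∨ v ∈ T) :
    G.Adj y z := by
  classical
  by_contra hnadj
  -- A shortest admissible walk is an induced path; closing it through `x` gives a chordless cycle
  -- of length at least 4.
  have hex : ∃ n, ∃ p : G.Walk y z, (∀ v ∈ p.support, v = y ∨ v = z ∨ v ∈ T) ∧ p.length = n := by
    obtain ⟨p, hp⟩ := hp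
    exact ⟨_, p, hp, rfl⟩
  obtain ⟨p, hps, hpl⟩ := Nat.find_spec hex
  have hmin : ∀ q : G.Walk y z, (∀ v ∈ q.support, v = y ∨ v = z ∨ v ∈ T) →
      p.length ≤ q.length := by
    intro q hq
    rw [hpl]
    exact Nat.find_min' hex ⟨q, hq, rfl⟩
  have hpath : p.IsPath := by
    rw [← p.bypass_eq_self_of_length_le_length_bypass
      (hmin _ fun v hv => hps v (p.support_bypass_subset_support hv))]
    exact p.bypass_isPath
  have hxp : x ∉ p.support := by
    intro h
    rcases hps x h with h | h | h
    · exact hxy.ne h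
    · exact hxz.ne h
    · exact hxT h
  have hlen : 2 ≤ p.length := by
    by_contra h
    have h01 : p.length = 0 ∨ p.length = 1 := by omega
    rcases h01 with h | h
    · exact hyz (Walk.eq_of_length_eq_zero h)
    · exact hnadj (Walk.adj_of_length_eq_one h)
  have hshort : ∀ i j, i ≤ j → j ≤ p.length → G.Adj (p.getVert i) (p.getVert j) → j ≤ i + 1 := by
    intro i j hij hj hadj
    have h := hmin ((p.take i).append (Walk.cons hadj (p.drop j))) (by
      intro v hv
      rw [Walk.mem_support_append_iff, Walk.support_cons, List.mem_cons] at hv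
      apply hps
      rcases hv with hv | hv | hv
      · rw [Walk.support_take] at hv
        exact List.mem_of_mem_take hv
      · exact hv ▸ p.getVert_mem_support i
      · rw [Walk.drop_support_eq_support_drop_min] at hv
        exact List.mem_of_mem_drop hv)
    simp only [Walk.length_append, Walk.length_cons, Walk.take_length, Walk.drop_length] at h
    omega
  have hchordless : ∀ a b, a ∈ p.support → b ∈ p.support → G.Adj a b → s(a, b) ∈ p.edges := by
    intro a b ha hb hab
    obtain ⟨i, rfl, hi⟩ := Walk.mem_support_iff_exists_getVert.1 ha
    obtain ⟨j, rfl, hj⟩ := Walk.mem_support_iff_exists_getVert.1 hb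
    rw [Walk.mk_mem_edges_iff_exists]
    rcases lt_trichotomy i j with h | h | h
    · have := hshort i j h.le hj hab
      obtain rfl : j = i + 1 := by omega
      exact ⟨i, by omega, rfl⟩
    · subst h
      exact absurd hab (G.irrefl)
    · have := hshort j i h.le hi hab.symm
      obtain rfl : i = j + 1 := by omega
      exact ⟨j, by omega, Sym2.eq_swap⟩
  have hcyc : (Walk.cons hxy (p.concat hxz.symm)).IsCycle := by
    rw [Walk.cons_isCycle_iff]
    refine ⟨hpath.concat hxp _, ?_⟩
    rw [Walk.edges_concat, List.concat_eq_append, List.mem_append, not_or]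
    refine ⟨fun h => hxp (p.fst_mem_support_of_mem_edges h), ?_⟩
    simp only [List.mem_singleton, Sym2.eq_iff]
    rintro (⟨h, -⟩ | ⟨-, h⟩)
    · exact hxz.ne h
    · exact hyz h
  obtain ⟨e, he⟩ := hG x _ hcyc (by
    rw [Walk.length_cons, Walk.length_concat]; omega)
  induction e using Sym2.ind with
  | _ a b =>
  rw [Walk.isChord_sym2Mk] at he
  obtain ⟨hab, hne, ha, hb⟩ := he
  have hx : ∀ b, b ∈ p.support → G.Adj x b → b = y ∨ b = z := by
    intro b hb hxb
    rcases hps b hb with h | h | h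
    · exact .inl h
    · exact .inr h
    · exact absurd hxb (hT b h)
  simp only [Walk.edges_cons, Walk.edges_concat, List.concat_eq_append, List.mem_cons,
    List.mem_append, List.not_mem_nil, or_false, not_or, Walk.support_cons,
    Walk.support_concat] at hne ha hb
  have ha' : a = x ∨ a ∈ p.support := by tauto
  have hb' : b = x ∨ b ∈ p.support := by tauto
  rcases ha' with rfl | ha' <;> rcases hb' with rfl | hb'
  · exact G.irrefl hab
  · rcases hx b hb' hab with rfl | rfl
    · exact hne.1 rfl
    · exact hne.2.2 Sym2.eq_swap
  · rcases hx a ha' hab.symm with rfl | rfl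
    · exact hne.1 Sym2.eq_swap
    · exact hne.2.2 rfl
  · exact hne.2.1 (hchordless a b ha' hb' hab)

/-- `v` is a simplicial vertex of the subgraph of `G` induced by `S`. -/
def IsSimplicialIn {V : Type*} (G : SimpleGraph V) (S : Finset V) (v : V) : Prop :=
  v ∈ S ∧ ∀ u ∈ S, ∀ w ∈ S, G.Adj v u → G.Adj v w → u ≠ w → G.Adj u w

/-- Every nonempty induced subgraph of `G` has a simplicial vertex. -/
def HasSimplicialElimination {V : Type*} (G : SimpleGraph V) : Prop :=
  ∀ S : Finset V, S.Nonempty → ∃ v, G.IsSimplicialIn S v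

/-- If no vertex of `S` satisfies the premise of `h`, then `S` is a clique and all its vertices are
simplicial. -/
theorem exists_isSimplicialIn_of_nonuniversal {V : Type*} {G : SimpleGraph V} {S : Finset V}
    (hS : S.Nonempty)
    (h : ∀ x ∈ S, (∃ y ∈ S, y ≠ x ∧ ¬ G.Adj x y) →
      ∃ v, G.IsSimplicialIn S v ∧ v ≠ x ∧ ¬ G.Adj x v) :
    ∃ v, G.IsSimplicialIn S v := by
  by_cases hu : ∃ x ∈ S, ∃ y ∈ S, y ≠ x ∧ ¬ G.Adj x y
  · obtain ⟨x, hx, hy⟩ := hu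
    obtain ⟨v, hv, -⟩ := h x hx hy
    exact ⟨v, hv⟩
  · push Not at hu
    obtain ⟨v, hv⟩ := hS
    exact ⟨v, hv, fun u hu' w hw _ _ huw => hu u hu' w hw huw.symm⟩

/-- In an induced subgraph of a chordal graph, a non-universal vertex `x` has a simplicial vertex
outside its closed neighbourhood. -/
theorem IsChordal.exists_isSimplicialIn_not_adj {V : Type*} {G : SimpleGraph V}
    (hG : G.IsChordal) (S : Finset V) :
    ∀ x ∈ S, (∃ y ∈ S, y ≠ x ∧ ¬ G.Adj x y) →
      ∃ v, G.IsSimplicialIn S v ∧ v ≠ x ∧ ¬ G.Adj x v := by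
  classical
  induction S using Finset.strongInduction with
  | H S ih =>
  rintro x hx ⟨y₀, hy₀S, hy₀x, hy₀⟩
  let T : Set V := {v | v ∈ S ∧ v ≠ x ∧ ¬ G.Adj x v}
  -- `C` is the component of `y₀` among the non-neighbours of `x`, and `B` below is its boundary.
  -- `B` lies in the neighbourhood of `x`, and paths through `C` make it a clique.
  let C : Finset V := {v ∈ S | ∃ p : G.Walk y₀ v, ∀ u ∈ p.support, u ∈ T}
  have hCT : ∀ v ∈ C, v ∈ T := by
    intro v hv
    obtain ⟨-, p, hp⟩ := Finset.mem_filter.1 hv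
    exact hp v p.end_mem_support
  have hCS : C ⊆ S := Finset.filter_subset _ _
  have hy₀C : y₀ ∈ C := Finset.mem_filter.2 ⟨hy₀S, Walk.nil, by
    intro u hu
    rw [Walk.support_nil, List.mem_singleton] at hu
    exact hu ▸ ⟨hy₀S, hy₀x, hy₀⟩⟩
  have hCext : ∀ c ∈ C, ∀ w ∈ T, G.Adj c w → w ∈ C := by
    intro c hc w hw hcw
    obtain ⟨-, p, hp⟩ := Finset.mem_filter.1 hc
    refine Finset.mem_filter.2 ⟨hw.1, p.concat hcw, ?_⟩
    intro u hu
    rw [Walk.support_concat, List.mem_append, List.mem_singleton] at hu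
    rcases hu with hu | rfl
    · exact hp u hu
    · exact hw
  let B : Finset V := {b ∈ S | b ∉ T ∧ ∃ c ∈ C, G.Adj c b}
  have hxB : ∀ b ∈ B, G.Adj x b := by
    intro b hb
    obtain ⟨hbS, hbT, c, hc, hcb⟩ := Finset.mem_filter.1 hb
    by_contra h
    refine hbT ⟨hbS, ?_, h⟩
    rintro rfl
    exact (hCT c hc).2.2 hcb.symm
  have hBclique : ∀ y ∈ B, ∀ z ∈ B, y ≠ z → G.Adj y z := by
    intro y hy z hz hyz
    obtain ⟨-, -, c, hc, hcy⟩ := Finset.mem_filter.1 hy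
    obtain ⟨-, -, d, hd, hdz⟩ := Finset.mem_filter.1 hz
    obtain ⟨-, p, hp⟩ := Finset.mem_filter.1 hc
    obtain ⟨-, q, hq⟩ := Finset.mem_filter.1 hd
    refine hG.adj_of_walk (T := T) (hxB y hy) (hxB z hz) (fun v hv => hv.2.2)
      (fun h => h.2.1 rfl) hyz ⟨Walk.cons hcy.symm ((p.reverse.append q).concat hdz), ?_⟩
    intro v hv
    rw [Walk.support_cons, List.mem_cons, Walk.support_concat,
      List.mem_append, List.mem_singleton, Walk.mem_support_append_iff, Walk.support_reverse,
      List.mem_reverse] at hv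
    rcases hv with hv | (hv | hv) | hv
    · exact .inl hv
    · exact .inr (.inr (hp v hv))
    · exact .inr (.inr (hq v hv))
    · exact .inr (.inl hv)
  have hN : ∀ c ∈ C, ∀ w ∈ S, G.Adj c w → w ∈ C ∪ B := by
    intro c hc w hw hcw
    by_cases hwT : w ∈ T
    · exact Finset.mem_union_left _ (hCext c hc w hwT hcw)
    · exact Finset.mem_union_right _ (Finset.mem_filter.2 ⟨hw, hwT, c, hc, hcw⟩)
  have hlift : ∀ v ∈ C, G.IsSimplicialIn (C ∪ B) v →
      ∃ v, G.IsSimplicialIn S v ∧ v ≠ x ∧ ¬ G.Adj x v := by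
    intro v hvC hv
    refine ⟨v, ⟨hCS hvC, fun u hu w hw hvu hvw huw => ?_⟩, (hCT v hvC).2⟩
    exact hv.2 u (hN v hvC u hu hvu) w (hN v hvC w hw hvw) hvu hvw huw
  have hxCB : x ∉ C ∪ B := by
    rw [Finset.mem_union, not_or]
    exact ⟨fun h => (hCT x h).2.1 rfl, fun h => G.irrefl (hxB x h)⟩
  have hCBS : C ∪ B ⊂ S := by
    refine (Finset.ssubset_iff_of_subset ?_).2 ⟨x, hx, hxCB⟩
    exact Finset.union_subset hCS (Finset.filter_subset _ _)
  -- If some `b` in `B` is not universal in `C ∪ B`, induction gives a simplicial vertex not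
  -- adjacent to `b`, which lies in `C` because `B` is a clique. Otherwise `B` is joined to
  -- everything, and a simplicial vertex of `C` alone stays simplicial in `C ∪ B`.
  by_cases hb : ∃ b ∈ B, ∃ y ∈ C ∪ B, y ≠ b ∧ ¬ G.Adj b y
  · obtain ⟨b, hbB, hy⟩ := hb
    obtain ⟨v, hv, hvb, hvadj⟩ := ih _ hCBS b (Finset.mem_union_right _ hbB) hy
    have hvC : v ∈ C := by
      rcases Finset.mem_union.1 hv.1 with h | h
      · exact h
      · exact absurd (hBclique b hbB v h hvb.symm) hvadj
    exact hlift v hvC hv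
  · push Not at hb
    have hCss : C ⊂ S := lt_of_le_of_lt (show C ≤ C ∪ B from Finset.subset_union_left) hCBS
    obtain ⟨v, hv⟩ := exists_isSimplicialIn_of_nonuniversal ⟨y₀, hy₀C⟩ (ih C hCss)
    refine hlift v hv.1 ⟨Finset.mem_union_left _ hv.1, ?_⟩
    intro u hu w hw hvu hvw huw
    by_cases huB : u ∈ B
    · exact hb u huB w hw huw.symm
    by_cases hwB : w ∈ B
    · exact (hb w hwB u hu huw).symm
    exact hv.2 u ((Finset.mem_union.1 hu).resolve_right huB) w
      ((Finset.mem_union.1 hw).resolve_right hwB) hvu hvw huw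

/-- Dirac's theorem. -/
theorem IsChordal.hasSimplicialElimination {V : Type*} {G : SimpleGraph V} (hG : G.IsChordal) :
    G.HasSimplicialElimination := fun S hS =>
  exists_isSimplicialIn_of_nonuniversal hS (hG.exists_isSimplicialIn_not_adj S)

/-- A vertex of `S` lying over a simplicial vertex of the projection of `S` is simplicial: copies of
one vertex are adjacent to each other and to the same other fibres. -/
theorem HasSimplicialElimination.lexProd_completeGraph {V ι : Type*} {G : SimpleGraph V}
    (hG : G.HasSimplicialElimination) :
    (G.lexProd (completeGraph ι)).HasSimplicialElimination := by
  classical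
  intro S hS
  obtain ⟨x, hxS, hx⟩ := hG (S.image Prod.fst) (hS.image _)
  obtain ⟨⟨x', a⟩, hxa, rfl⟩ := Finset.mem_image.1 hxS
  refine ⟨(x', a), hxa, ?_⟩
  rintro ⟨u, b⟩ hu ⟨w, c⟩ hw hvu hvw huw
  have hsame : u = w → (G.lexProd (completeGraph ι)).Adj (u, b) (w, c) := by
    rintro rfl
    refine .inl ⟨rfl, ?_⟩
    rw [completeGraph_eq_top, top_adj]
    rintro rfl
    exact huw rfl
  rcases hvu with ⟨h, -⟩ | hvu <;> rcases hvw with ⟨h', -⟩ | hvw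
  · exact hsame (h.symm.trans h')
  · exact .inr (by obtain rfl : x' = u := h; exact hvw)
  · exact .inr (by obtain rfl : x' = w := h'; exact hvu.symm)
  · by_cases he : u = w
    · exact hsame he
    · exact .inr (hx u (Finset.mem_image_of_mem Prod.fst hu) w
        (Finset.mem_image_of_mem Prod.fst hw) hvu hvw he)

/-! ### b-colorings of induced subgraphs and deletion of simplicial vertices -/

/-- `v` has neighbours in `S` of all colours of `K` other than its own. -/
def IsBVertexOn {V α : Type*} (G : SimpleGraph V) (S : Finset V) (K : Finset α) (c : V → α)
    (v : V) : Prop :=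
  ∀ j ∈ K, j ≠ c v → ∃ w ∈ S, G.Adj v w ∧ c w = j

/-- `c` restricts to a b-coloring, with set of colours `K`, of the subgraph induced by `S`. -/
structure IsBColoringOn {V α : Type*} (G : SimpleGraph V) (S : Finset V) (K : Finset α)
    (c : V → α) : Prop where
  mem : ∀ v ∈ S, c v ∈ K
  proper : ∀ u ∈ S, ∀ v ∈ S, G.Adj u v → c u ≠ c v
  exists_bVertex : ∀ i ∈ K, ∃ v ∈ S, c v = i ∧ G.IsBVertexOn S K c v

theorem IsBColoringOn.card_mem_bSpectrum {V α : Type*} [Fintype V] {G : SimpleGraph V}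
    {K : Finset α} {c : V → α} (hc : G.IsBColoringOn Finset.univ K c) (hK : 0 < K.card) :
    K.card ∈ G.bSpectrum := by
  let C : G.Coloring (Fin K.card) := Coloring.mk
    (fun v => K.equivFin ⟨c v, hc.mem v (Finset.mem_univ v)⟩) (by
      intro u v huv h
      have := K.equivFin.injective h
      exact hc.proper u (Finset.mem_univ u) v (Finset.mem_univ v) huv (congrArg Subtype.val this))
  have hC : ∀ v (i : K), C v = K.equivFin i ↔ c v = i := by
    intro v i
    change K.equivFin _ = _ ↔ _
    rw [K.equivFin.apply_eq_iff_eq, Subtype.ext_iff]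
  refine ⟨hK, C, fun i => ?_⟩
  obtain ⟨i, rfl⟩ := K.equivFin.surjective i
  obtain ⟨v, -, hv, hb⟩ := hc.exists_bVertex i i.2
  refine ⟨v, (hC v i).2 hv, fun j hj => ?_⟩
  obtain ⟨j, rfl⟩ := K.equivFin.surjective j
  obtain ⟨w, -, hvw, hw⟩ := hb j j.2 (fun h => hj ((hC v j).2 h.symm).symm)
  exact ⟨w, hvw, (hC w j).2 hw⟩

theorem Coloring.IsBColoring.isBColoringOn {V α : Type*} [Fintype V] [Fintype α]
    {G : SimpleGraph V} {C : G.Coloring α} (hC : C.IsBColoring) :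
    G.IsBColoringOn Finset.univ Finset.univ C where
  mem _ _ := Finset.mem_univ _
  proper _ _ _ _ h := C.valid h
  exists_bVertex i _ := by
    obtain ⟨v, hv, hb⟩ := hC i
    refine ⟨v, Finset.mem_univ v, hv, fun j _ hj => ?_⟩
    obtain ⟨w, hw⟩ := hb j hj
    exact ⟨w, Finset.mem_univ w, hw⟩

theorem IsSimplicialIn.isClique_closedNeighbors {V : Type*} [DecidableEq V] {G : SimpleGraph V}
    [DecidableRel G.Adj] {S : Finset V} {v : V} (hv : G.IsSimplicialIn S v) :
    G.IsClique (insert v {u ∈ S | G.Adj v u} : Finset V) := by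
  rw [Finset.coe_insert, isClique_insert]
  refine ⟨?_, ?_⟩
  · intro a ha b hb hab
    obtain ⟨ha, hva⟩ := Finset.mem_filter.1 (Finset.mem_coe.1 ha)
    obtain ⟨hb, hvb⟩ := Finset.mem_filter.1 (Finset.mem_coe.1 hb)
    exact hv.2 a ha b hb hva hvb hab
  · intro b hb _
    exact (Finset.mem_filter.1 (Finset.mem_coe.1 hb)).2

/-- If the cliques in `S` have at most `n` vertices then a simplicial vertex of `S` has fewer
than `n` neighbours in `S`. -/
theorem IsSimplicialIn.card_filter_adj_lt {V : Type*} {G : SimpleGraph V}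
    [DecidableRel G.Adj] {S : Finset V} {v : V} (hv : G.IsSimplicialIn S v) {n : ℕ}
    (hn : ∀ Q ⊆ S, G.IsClique (Q : Set V) → Q.card ≤ n) :
    ({u ∈ S | G.Adj v u} : Finset V).card < n := by
  classical
  have h := hn _ (Finset.insert_subset hv.1 (Finset.filter_subset _ _)) hv.isClique_closedNeighbors
  rw [Finset.card_insert_of_notMem (by simp)] at h
  exact h

/-- If `v` has fewer than `#K` neighbours in `S`, some colour of `K` is free for it. -/
theorem exists_color_not_on_neighbors {V α : Type*} {G : SimpleGraph V} [DecidableRel G.Adj]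
    {S : Finset V} {v : V} {K : Finset α} (c : V → α)
    (h : ({u ∈ S | G.Adj v u} : Finset V).card < K.card) :
    ∃ a ∈ K, ∀ u ∈ S, G.Adj v u → c u ≠ a := by
  classical
  obtain ⟨a, haK, ha⟩ := Finset.exists_mem_notMem_of_card_lt_card
    (lt_of_le_of_lt (Finset.card_image_le (f := c)) h)
  refine ⟨a, haK, fun u hu hvu hca => ha ?_⟩
  exact Finset.mem_image.2 ⟨u, Finset.mem_filter.2 ⟨hu, hvu⟩, hca⟩

/-- A b-coloring of `S` minus a vertex extends to `S` if a colour is free for that vertex. -/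
theorem IsBColoringOn.extend {V α : Type*} [DecidableEq V] {G : SimpleGraph V} {S : Finset V}
    {K : Finset α} {c : V → α} {v : V} (hc : G.IsBColoringOn (S.erase v) K c) {a : α}
    (haK : a ∈ K) (ha : ∀ u ∈ S, G.Adj v u → c u ≠ a) :
    G.IsBColoringOn S K (Function.update c v a) where
  mem u hu := by
    by_cases h : u = v
    · subst h; simpa using haK
    · simpa [h] using hc.mem u (Finset.mem_erase.2 ⟨h, hu⟩)
  proper u hu w hw huw := by
    by_cases h : u = v <;> by_cases h' : w = v
    · subst h; subst h'; exact absurd huw G.irrefl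
    · subst h; simpa [h'] using (ha w hw huw).symm
    · subst h'; simpa [h] using ha u hu huw.symm
    · simpa [h, h'] using
        hc.proper u (Finset.mem_erase.2 ⟨h, hu⟩) w (Finset.mem_erase.2 ⟨h', hw⟩) huw
  exists_bVertex i hi := by
    obtain ⟨u, hu, hui, hb⟩ := hc.exists_bVertex i hi
    have huv := Finset.mem_erase.1 hu
    refine ⟨u, huv.2, by simpa [huv.1] using hui, fun j hj hju => ?_⟩
    rw [Function.update_of_ne huv.1] at hju
    obtain ⟨w, hw, huw, hwj⟩ := hb j hj hju
    have hwv := Finset.mem_erase.1 hw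
    exact ⟨w, hwv.2, huw, by simpa [hwv.1] using hwj⟩

/-- Deleting a simplicial vertex of small degree costs a b-coloring at most one colour. -/
theorem IsBColoringOn.exists_erase {V α : Type*} [DecidableEq V] [DecidableEq α]
    {G : SimpleGraph V} [DecidableRel G.Adj] {S : Finset V} {K : Finset α} {c : V → α}
    (hc : G.IsBColoringOn S K c) {v : V} (hv : G.IsSimplicialIn S v)
    (hdeg : ({u ∈ S | G.Adj v u} : Finset V).card + 1 < K.card) :
    G.IsBColoringOn (S.erase v) K c ∨
      ∃ i ∈ K, ∃ c', G.IsBColoringOn (S.erase v) (K.erase i) c' := by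
  -- A b-vertex needs at least `K.card - 1` neighbours.
  have hvb : ¬ G.IsBVertexOn S K c v := by
    intro h
    have h' : (K.erase (c v)).card ≤ ({u ∈ S | G.Adj v u} : Finset V).card := by
      refine (Finset.card_le_card fun j hj => ?_).trans (Finset.card_image_le (f := c))
      obtain ⟨hj, hjK⟩ := Finset.mem_erase.1 hj
      obtain ⟨w, hw, hvw, hwj⟩ := h j hjK hj
      exact Finset.mem_image.2 ⟨w, Finset.mem_filter.2 ⟨hw, hvw⟩, hwj⟩
    rw [Finset.card_erase_of_mem (hc.mem v hv.1)] at h'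
    omega
  by_cases hall : ∀ i ∈ K, ∃ u ∈ S.erase v, c u = i ∧ G.IsBVertexOn (S.erase v) K c u
  · exact .inl ⟨fun u hu => hc.mem u (Finset.mem_of_mem_erase hu),
      fun u hu w hw => hc.proper u (Finset.mem_of_mem_erase hu) w (Finset.mem_of_mem_erase hw),
      hall⟩
  push Not at hall
  obtain ⟨i, hiK, hi⟩ := hall
  refine .inr ⟨i, hiK, ?_⟩
  -- Colour `i` has lost its b-vertices, so each vertex of its class misses some colour. The value
  -- `c v` outside the class is a dummy.
  have hmiss : ∀ u, ∃ a, u ∈ S.erase v → c u = i →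
      a ∈ K.erase i ∧ ∀ w ∈ S.erase v, G.Adj u w → c w ≠ a := by
    intro u
    by_cases h : u ∈ S.erase v ∧ c u = i
    · have hb := hi u h.1 h.2
      unfold IsBVertexOn at hb
      push Not at hb
      obtain ⟨a, haK, hau, ha⟩ := hb
      exact ⟨a, fun _ _ => ⟨Finset.mem_erase.2 ⟨h.2 ▸ hau, haK⟩, ha⟩⟩
    · exact ⟨c v, fun h₁ h₂ => absurd ⟨h₁, h₂⟩ h⟩
  choose m hm using hmiss
  obtain ⟨u, huS, hui, hub⟩ := hc.exists_bVertex i hiK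
  have huv : u ≠ v := by rintro rfl; exact hvb hub
  have huS' : u ∈ S.erase v := Finset.mem_erase.2 ⟨huv, huS⟩
  obtain ⟨hmuK, hmu⟩ := hm u huS' hui
  -- The vertex `u` was a b-vertex before the deletion, so the only colour it can miss is that of
  -- `v`.
  have hmuv : G.Adj u v ∧ c v = m u := by
    obtain ⟨hne, hK⟩ := Finset.mem_erase.1 hmuK
    obtain ⟨w, hw, huw, hcw⟩ := hub (m u) hK (hui ▸ hne)
    by_cases hwv : w = v
    · exact hwv ▸ ⟨huw, hcw⟩
    · exact absurd hcw (hmu w (Finset.mem_erase.2 ⟨hwv, hw⟩) huw)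
  -- Class `i` is independent, so its vertices can be moved to their missing colours independently
  -- of each other.
  refine ⟨fun w => if c w = i then m w else c w, ?_, ?_, ?_⟩
  · intro w hw
    by_cases h : c w = i
    · simpa only [h, if_true] using (hm w hw h).1
    · simpa only [h, if_false] using
        Finset.mem_erase.2 ⟨h, hc.mem w (Finset.mem_of_mem_erase hw)⟩
  · intro a ha b hb hab
    have hne := hc.proper a (Finset.mem_of_mem_erase ha) b (Finset.mem_of_mem_erase hb) hab
    by_cases h : c a = i <;> by_cases h' : c b = i
    · exact absurd (h.trans h'.symm) hne
    · simpa only [h, h', if_true, if_false] using ((hm a ha h).2 b hb hab).symm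
    · simpa only [h, h', if_true, if_false] using (hm b hb h').2 a ha hab.symm
    · simpa only [h, h', if_false] using hne
  · intro l hl
    obtain ⟨hli, hlK⟩ := Finset.mem_erase.1 hl
    obtain ⟨b, hbS, hbl, hb⟩ := hc.exists_bVertex l hlK
    have hbv : b ≠ v := by rintro rfl; exact hvb hb
    have hbi : c b ≠ i := hbl ▸ hli
    refine ⟨b, Finset.mem_erase.2 ⟨hbv, hbS⟩, by simpa only [hbi, if_false] using hbl, ?_⟩
    intro j hj hjb
    simp only [hbi, if_false] at hjb
    obtain ⟨hji, hjK⟩ := Finset.mem_erase.1 hj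
    obtain ⟨w, hw, hbw, hwj⟩ := hb j hjK hjb
    -- If `b` saw this colour at the deleted vertex, then `u` replaces it: `u` now has that colour,
    -- and `u` and `b`, both neighbours of a simplicial vertex, are adjacent.
    by_cases hwv : w = v
    · subst hwv
      refine ⟨u, huS', ?_, ?_⟩
      · refine hv.2 b hbS u huS hbw.symm hmuv.1.symm ?_
        rintro rfl
        exact hbi hui
      · simp only [hui, if_true]
        exact hmuv.2.symm.trans hwj
    · refine ⟨w, Finset.mem_erase.2 ⟨hwv, hw⟩, hbw, ?_⟩
      have hwi : c w ≠ i := hwj ▸ hji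
      simpa only [hwi, if_false] using hwj

/-- Graphs with a simplicial elimination scheme have b-colorings with any number of colours
between their clique number and the number of colours of a given b-coloring. -/
theorem HasSimplicialElimination.exists_isBColoringOn {V α : Type*} {G : SimpleGraph V}
    (hG : G.HasSimplicialElimination) (n : ℕ) (S : Finset V) :
    ∀ (K : Finset α) (c : V → α), G.IsBColoringOn S K c →
      (∀ Q ⊆ S, G.IsClique (Q : Set V) → Q.card ≤ n) → n ≤ K.card →
      ∃ (K' : Finset α) (c' : V → α), K'.card = n ∧ G.IsBColoringOn S K' c' := by
  classical
  induction S using Finset.strongInduction with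
  | H S ih =>
  intro K c hc hn hnK
  rcases hnK.eq_or_lt with h | hlt
  · exact ⟨K, c, h.symm, hc⟩
  have hS : S.Nonempty := by
    obtain ⟨i, hi⟩ := Finset.card_pos.1 (Nat.zero_lt_of_lt hlt)
    obtain ⟨v, hv, -⟩ := hc.exists_bVertex i hi
    exact ⟨v, hv⟩
  obtain ⟨v, hv⟩ := hG S hS
  have hdeg := hv.card_filter_adj_lt hn
  have hn' : ∀ Q ⊆ S.erase v, G.IsClique (Q : Set V) → Q.card ≤ n :=
    fun Q hQ => hn Q (hQ.trans (Finset.erase_subset _ _))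
  have hrec : ∃ (K' : Finset α) (c' : V → α),
      K'.card = n ∧ G.IsBColoringOn (S.erase v) K' c' := by
    -- The degree of `v` is below `n` and `n < K.card`, so the degree bound holds and losing one
    -- colour still leaves at least `n`.
    rcases hc.exists_erase hv (by omega) with h | ⟨i, hi, c', h⟩
    · exact ih _ (Finset.erase_ssubset hv.1) K c h hn' hnK
    · refine ih _ (Finset.erase_ssubset hv.1) _ c' h hn' ?_
      rw [Finset.card_erase_of_mem hi]
      omega
  obtain ⟨K', c', hK', hc'⟩ := hrec
  obtain ⟨a, haK, ha⟩ := exists_color_not_on_neighbors (K := K') c' (hdeg.trans_eq hK'.symm)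
  exact ⟨K', _, hK', hc'.extend haK ha⟩

/-! ### Optimal proper colorings and the ends of the b-spectrum -/

theorem HasSimplicialElimination.exists_proper {V : Type*} {G : SimpleGraph V}
    (hG : G.HasSimplicialElimination) (n : ℕ) (hn : 0 < n) (S : Finset V) :
    (∀ Q ⊆ S, G.IsClique (Q : Set V) → Q.card ≤ n) →
      ∃ c : V → Fin n, ∀ u ∈ S, ∀ v ∈ S, G.Adj u v → c u ≠ c v := by
  classical
  induction S using Finset.strongInduction with
  | H S ih =>
  intro hcl
  rcases S.eq_empty_or_nonempty with rfl | hS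
  · exact ⟨fun _ => ⟨0, hn⟩, by simp⟩
  obtain ⟨v, hv⟩ := hG S hS
  obtain ⟨c, hc⟩ := ih _ (Finset.erase_ssubset hv.1)
    fun Q hQ => hcl Q (hQ.trans (Finset.erase_subset _ _))
  obtain ⟨a, -, ha⟩ := exists_color_not_on_neighbors (K := (Finset.univ : Finset (Fin n))) c
    ((hv.card_filter_adj_lt hcl).trans_eq (Finset.card_fin n).symm)
  refine ⟨Function.update c v a, fun u hu w hw huw => ?_⟩
  by_cases h : u = v <;> by_cases h' : w = v
  · subst h; subst h'; exact absurd huw G.irrefl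
  · subst h; simpa [h'] using (ha w hw huw).symm
  · subst h'; simpa [h] using ha u hu huw.symm
  · simpa [h, h'] using hc u (Finset.mem_erase.2 ⟨h, hu⟩) w (Finset.mem_erase.2 ⟨h', hw⟩) huw

theorem HasSimplicialElimination.colorable_cliqueNum {V : Type*} [Finite V] [Nonempty V]
    {G : SimpleGraph V} (hG : G.HasSimplicialElimination) : G.Colorable G.cliqueNum := by
  have := Fintype.ofFinite V
  have hcl : ∀ Q : Finset V, G.IsClique (Q : Set V) → Q.card ≤ G.cliqueNum :=
    fun Q hQ => hQ.card_le_cliqueNum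
  have hpos : 0 < G.cliqueNum :=
    (hcl {Classical.arbitrary V} (by simp)).trans_lt' (by simp)
  obtain ⟨c, hc⟩ := hG.exists_proper G.cliqueNum hpos Finset.univ fun Q _ => hcl Q
  exact ⟨Coloring.mk c fun {u v} huv => hc u (Finset.mem_univ u) v (Finset.mem_univ v) huv⟩

theorem le_bChromaticNumber {V : Type*} [Finite V] {G : SimpleGraph V} {k : ℕ}
    (hk : k ∈ G.bSpectrum) : k ≤ G.bChromaticNumber :=
  le_csSup G.bSpectrum_bddAbove hk

/-- An optimal proper coloring is a b-coloring. -/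
theorem exists_chromaticNumber_eq_mem_bSpectrum {V : Type*} [Finite V] [Nonempty V]
    (G : SimpleGraph V) : ∃ h : ℕ, G.chromaticNumber = h ∧ h ∈ G.bSpectrum := by
  classical
  have := Fintype.ofFinite V
  obtain ⟨h, hh⟩ := ENat.ne_top_iff_exists.1
    (chromaticNumber_ne_top_iff_exists.2 ⟨_, G.colorable_of_fintype⟩)
  obtain ⟨C⟩ := chromaticNumber_le_iff_colorable.1 hh.ge
  have hpos : 0 < h := Fin.pos (C (Classical.arbitrary V))
  refine ⟨h, hh.symm, hpos, C, ?_⟩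
  -- A class without a b-vertex could be dissolved by moving each of its vertices to a colour it
  -- misses, leaving a proper coloring with `h - 1` colours.
  by_contra hC
  unfold Coloring.IsBColoring at hC
  push Not at hC
  obtain ⟨i, hi⟩ := hC
  have hmiss : ∀ v, ∃ j, C v = i → j ≠ i ∧ ∀ w, G.Adj v w → C w ≠ j := by
    intro v
    by_cases hv : C v = i
    · have hb := hi v hv
      unfold Coloring.IsBVertex at hb
      push Not at hb
      obtain ⟨j, hj, hw⟩ := hb
      exact ⟨j, fun _ => ⟨hv ▸ hj, hw⟩⟩
    · exact ⟨i, fun h => absurd h hv⟩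
  choose m hm using hmiss
  let D : G.Coloring {j // j ≠ i} := Coloring.mk
    (fun v => if hv : C v = i then ⟨m v, (hm v hv).1⟩ else ⟨C v, hv⟩) (by
      intro v w hvw heq
      have hne := C.valid hvw
      by_cases hv : C v = i <;> by_cases hw : C w = i
      · exact hne (hv.trans hw.symm)
      · simp only [hv, hw, dif_pos, dif_neg, not_false_eq_true, Subtype.mk.injEq] at heq
        exact (hm v hv).2 w hvw heq.symm
      · simp only [hv, hw, dif_pos, dif_neg, not_false_eq_true, Subtype.mk.injEq] at heq
        exact (hm w hw).2 v hvw.symm heq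
      · simp only [hv, hw, dif_neg, not_false_eq_true, Subtype.mk.injEq] at heq
        exact hne heq)
  have hD := chromaticNumber_le_iff_colorable.2 D.colorable
  rw [← hh, Fintype.card_subtype_compl, Fintype.card_fin, Fintype.card_subtype_eq,
    Nat.cast_le] at hD
  omega

theorem bChromaticNumber_mem_bSpectrum {V : Type*} [Finite V] [Nonempty V]
    (G : SimpleGraph V) : G.bChromaticNumber ∈ G.bSpectrum := by
  obtain ⟨h, -, hh⟩ := G.exists_chromaticNumber_eq_mem_bSpectrum
  exact Nat.sSup_mem ⟨h, hh⟩ G.bSpectrum_bddAbove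

/-- On the empty graph b-continuity would put 0 in the b-spectrum, whose elements are positive. -/
theorem IsBContinuous.nonempty {V : Type*} {G : SimpleGraph V} (hG : G.IsBContinuous) :
    Nonempty V := by
  by_contra h
  rw [not_nonempty_iff] at h
  exact (hG 0 (chromaticNumber_le_iff_colorable.2 (.of_isEmpty 0)) (Nat.zero_le _)).1.false

/-! ### Palettes on the fibres of a lexicographic product -/

/-- b-colorings of the fibres of `G[H]` with palettes `L x` combine to a b-coloring of `G[H]`. -/
theorem lexProd_mem_bSpectrum {V W : Type*} {G : SimpleGraph V} {H : SimpleGraph W} {k : ℕ}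
    (hk : 0 < k) (L : V → Finset (Fin k)) (hL : ∀ x, (L x).card ∈ H.bSpectrum)
    (hdisj : ∀ x y, G.Adj x y → Disjoint (L x) (L y))
    (hb : ∀ i, ∃ x, i ∈ L x ∧ ∀ j, j ∉ L x → ∃ y, G.Adj x y ∧ j ∈ L y) :
    k ∈ (G.lexProd H).bSpectrum := by
  choose D hD using fun x => (hL x).2
  let e : ∀ x, Fin (L x).card ≃ L x := fun x => (L x).equivFin.symm
  have hmem : ∀ x y, (e x (D x y) : Fin k) ∈ L x := fun x y => (e x (D x y)).2
  have hsurj : ∀ x, ∀ j ∈ L x, ∃ y, (e x (D x y) : Fin k) = j := by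
    intro x j hj
    obtain ⟨l, hl⟩ := (e x).surjective ⟨j, hj⟩
    obtain ⟨y, hy, -⟩ := hD x l
    exact ⟨y, by rw [hy, hl]⟩
  let C : (G.lexProd H).Coloring (Fin k) := Coloring.mk (fun p => (e p.1 (D p.1 p.2) : Fin k)) (by
    rintro ⟨x, y⟩ ⟨x', y'⟩ (⟨h, hadj⟩ | hadj) heq
    · obtain rfl : x = x' := h
      exact (D x).valid hadj ((e x).injective (Subtype.ext heq))
    · refine Finset.disjoint_left.1 (hdisj x x' hadj) (hmem x y) ?_
      change (e x (D x y) : Fin k) = e x' (D x' y') at heq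
      exact heq ▸ hmem x' y')
  refine ⟨hk, C, fun i => ?_⟩
  obtain ⟨x, hix, hx⟩ := hb i
  obtain ⟨l, hl⟩ := (e x).surjective ⟨i, hix⟩
  obtain ⟨y, hy, hyb⟩ := hD x l
  have hC : C (x, y) = i := by
    change (e x (D x y) : Fin k) = i
    rw [hy, hl]
  refine ⟨(x, y), hC, fun j hj => ?_⟩
  -- Colours of the palette of `x` are seen inside the fibre, since `y` is a b-vertex there; the
  -- others in an adjacent fibre, which uses its whole palette.
  by_cases hjx : j ∈ L x
  · obtain ⟨l', hl'⟩ := (e x).surjective ⟨j, hjx⟩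
    obtain ⟨z, hyz, hz⟩ := hyb l' (by
      rintro rfl
      apply hj
      change j = (e x (D x y) : Fin k)
      rw [hl'])
    refine ⟨(x, z), .inl ⟨rfl, hyz⟩, ?_⟩
    change (e x (D x z) : Fin k) = j
    rw [hz, hl']
  · obtain ⟨x', hxx', hjx'⟩ := hx j hjx
    obtain ⟨z, hz⟩ := hsurj x' j hjx'
    exact ⟨(x', z), .inr hxx', hz⟩

/-- Disjoint palettes on the fibres over a clique bound `χ(G[H])` from below. -/
theorem cliqueNum_mul_le_of_lexProd_colorable {V W : Type*} [Finite V] {G : SimpleGraph V}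
    {H : SimpleGraph W} [Finite W] {h k : ℕ} (hh : H.chromaticNumber = h)
    (hk : (G.lexProd H).Colorable k) : G.cliqueNum * h ≤ k := by
  classical
  have := Fintype.ofFinite V
  have := Fintype.ofFinite W
  obtain ⟨C⟩ := hk
  obtain ⟨Q, hQ⟩ := G.exists_isNClique_cliqueNum
  let F : V → Finset (Fin k) := fun x => Finset.univ.image fun y => C (x, y)
  have hF : ∀ x, h ≤ (F x).card := by
    intro x
    let D : H.Coloring (F x) := Coloring.mk
      (fun y => ⟨C (x, y), Finset.mem_image_of_mem _ (Finset.mem_univ y)⟩) (by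
        intro y z hyz heq
        have hadj : (G.lexProd H).Adj (x, y) (x, z) := .inl ⟨rfl, hyz⟩
        exact C.valid hadj (congrArg Subtype.val heq))
    have hD := chromaticNumber_le_iff_colorable.2 D.colorable
    rwa [hh, Fintype.card_coe, Nat.cast_le] at hD
  have hdisj : (Q : Set V).PairwiseDisjoint F := by
    intro x hx x' hx' hne
    rw [Function.onFun, Finset.disjoint_left]
    intro a ha ha'
    obtain ⟨y, -, rfl⟩ := Finset.mem_image.1 ha
    obtain ⟨y', -, heq⟩ := Finset.mem_image.1 ha'
    have hadj : (G.lexProd H).Adj (x, y) (x', y') := .inr (hQ.isClique hx hx' hne)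
    exact C.valid hadj heq.symm
  calc G.cliqueNum * h = ∑ x ∈ Q, h := by rw [Finset.sum_const, hQ.card_eq, smul_eq_mul]
    _ ≤ ∑ x ∈ Q, (F x).card := Finset.sum_le_sum fun x _ => hF x
    _ = (Q.biUnion F).card := (Finset.card_biUnion hdisj).symm
    _ ≤ k := (Finset.card_le_univ _).trans_eq (Fintype.card_fin k)

/-- A clique of `G[K_t]` has at most `ω(G) t` vertices. -/
theorem IsClique.card_le_of_lexProd_completeGraph {V : Type*} [Finite V] {G : SimpleGraph V}
    {t : ℕ} {Q : Finset (V × Fin t)}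
    (hQ : (G.lexProd (completeGraph (Fin t))).IsClique (Q : Set (V × Fin t))) :
    Q.card ≤ G.cliqueNum * t := by
  classical
  have hclique : G.IsClique (Q.image Prod.fst : Finset V) := by
    intro x hx y hy hxy
    obtain ⟨p, hp, rfl⟩ := Finset.mem_image.1 (Finset.mem_coe.1 hx)
    obtain ⟨q, hq, rfl⟩ := Finset.mem_image.1 (Finset.mem_coe.1 hy)
    rcases hQ hp hq (fun h => hxy (congrArg Prod.fst h)) with ⟨h, -⟩ | h
    · exact absurd h hxy
    · exact h
  have hsub : Q ⊆ Q.image Prod.fst ×ˢ Finset.univ := fun p hp =>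
    Finset.mem_product.2 ⟨Finset.mem_image_of_mem _ hp, Finset.mem_univ _⟩
  calc Q.card ≤ (Q.image Prod.fst).card * t := by
        simpa [Finset.card_product] using Finset.card_le_card hsub
    _ ≤ G.cliqueNum * t := Nat.mul_le_mul_right t (IsClique.card_le_cliqueNum (tc := hclique))

/-- Greedy choice: the first term is as large as possible, at most `t`, while leaving `h` for each
of the `m` others. -/
theorem exists_sum_fin_eq {h t : ℕ} (ht : h ≤ t) (m k : ℕ) (hl : m * h ≤ k) (hu : k ≤ m * t) :
    ∃ n : Fin m → ℕ, (∀ j, h ≤ n j ∧ n j ≤ t) ∧ ∑ j, n j = k := by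
  induction m generalizing k with
  | zero => exact ⟨fun _ => h, fun j => j.elim0, by simp; omega⟩
  | succ m ih =>
    rw [Nat.succ_mul] at hl hu
    obtain ⟨n, hn, hsum⟩ := ih (k - min t (k - m * h)) (by omega) (by
      have := Nat.mul_le_mul_left m ht
      omega)
    refine ⟨Fin.cons (min t (k - m * h)) n, Fin.forall_fin_succ.2 ⟨?_, ?_⟩, ?_⟩
    · simp only [Fin.cons_zero]; omega
    · simpa using hn
    · rw [Fin.sum_cons, hsum]; omega

/-- If `G` is `ω(G)`-colorable, mixing b-colorings of `H` with `h, …, t` colours on its colour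
classes gives b-colorings of `G[H]` with `ω(G) h, …, ω(G) t` colours. -/
theorem lexProd_mem_bSpectrum_of_le_mul {V W : Type*} [Finite V] {G : SimpleGraph V}
    {H : SimpleGraph W} (hG : G.Colorable G.cliqueNum) {h t k : ℕ} (ht : h ≤ t)
    (hH : ∀ s, h ≤ s → s ≤ t → s ∈ H.bSpectrum) (hk : 0 < k) (hl : G.cliqueNum * h ≤ k)
    (hu : k ≤ G.cliqueNum * t) : k ∈ (G.lexProd H).bSpectrum := by
  classical
  obtain ⟨c⟩ := hG
  obtain ⟨Q, hQ⟩ := G.exists_isNClique_cliqueNum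
  obtain ⟨n, hn, hsum⟩ := exists_sum_fin_eq ht _ k hl hu
  -- A clique of ω(G) vertices receives all ω(G) colours.
  have hsurj : ∀ j, ∃ x ∈ Q, c x = j := by
    have himg : Q.image c = Finset.univ := by
      apply Finset.eq_univ_of_card
      rw [Finset.card_image_of_injOn, hQ.card_eq, Fintype.card_fin]
      intro x hx y hy hxy
      by_contra hne
      exact c.valid (hQ.isClique hx hy hne) hxy
    intro j
    exact Finset.mem_image.1 (himg ▸ Finset.mem_univ j)
  -- The `k` colours are cut into blocks of sizes `n j`; the palette of `x` will be the block of the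
  -- colour `c x`.
  let e : (Σ j, Fin (n j)) ≃ Fin k := Fintype.equivFinOfCardEq (by simp [hsum])
  let β : Fin k → Fin G.cliqueNum := fun i => (e.symm i).1
  have hβ : ∀ j, ({i | β i = j} : Finset (Fin k)).card = n j := by
    intro j
    have hset : ({i | β i = j} : Finset (Fin k)) =
        Finset.univ.map ((Function.Embedding.sigmaMk j).trans e.toEmbedding) := by
      ext i
      simp only [Finset.mem_filter, Finset.mem_univ, true_and, Finset.mem_map,
        Function.Embedding.trans_apply, Function.Embedding.sigmaMk_apply,
        Equiv.coe_toEmbedding, β]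
      constructor
      · rintro rfl
        exact ⟨(e.symm i).2, by simp⟩
      · rintro ⟨a, rfl⟩
        simp
    rw [hset, Finset.card_map, Finset.card_univ, Fintype.card_fin]
  refine lexProd_mem_bSpectrum hk (fun x => {i | β i = c x}) (fun x => ?_) ?_ ?_
  · rw [hβ]
    exact hH _ (hn _).1 (hn _).2
  · intro x y hxy
    rw [Finset.disjoint_left]
    intro i hi hi'
    exact c.valid hxy ((Finset.mem_filter.1 hi).2.symm.trans (Finset.mem_filter.1 hi').2)
  · intro i
    obtain ⟨x, hxQ, hx⟩ := hsurj (β i)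
    refine ⟨x, Finset.mem_filter.2 ⟨Finset.mem_univ i, hx.symm⟩, fun j hj => ?_⟩
    obtain ⟨y, hyQ, hy⟩ := hsurj (β j)
    refine ⟨y, hQ.isClique hxQ hyQ ?_, Finset.mem_filter.2 ⟨Finset.mem_univ j, hy.symm⟩⟩
    rintro rfl
    exact hj (Finset.mem_filter.2 ⟨Finset.mem_univ j, hy.symm⟩)

/-- `S_b(G[K_t]) ⊆ S_b(G[H])` when `t ∈ S_b(H)`. -/
theorem lexProd_bSpectrum_subset {V W : Type*} {G : SimpleGraph V} {H : SimpleGraph W} {t : ℕ}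
    (ht : t ∈ H.bSpectrum) :
    (G.lexProd (completeGraph (Fin t))).bSpectrum ⊆ (G.lexProd H).bSpectrum := by
  classical
  rintro k ⟨hk, C, hC⟩
  -- Each fibre of G[K_t] is a clique, so its palette has exactly `t` colours.
  have hinj : ∀ x, Function.Injective fun a => C (x, a) := by
    intro x a b hab
    by_contra hne
    have hadj : (G.lexProd (completeGraph (Fin t))).Adj (x, a) (x, b) :=
      .inl ⟨rfl, by rwa [completeGraph_eq_top, top_adj]⟩
    exact C.valid hadj hab
  have hmem : ∀ x a, C (x, a) ∈ Finset.univ.image fun a => C (x, a) := fun x a =>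
    Finset.mem_image_of_mem (fun a => C (x, a)) (Finset.mem_univ a)
  refine lexProd_mem_bSpectrum hk (fun x => Finset.univ.image fun a => C (x, a))
    (fun x => ?_) ?_ ?_
  · rwa [Finset.card_image_of_injective _ (hinj x), Finset.card_fin]
  · intro x y hxy
    rw [Finset.disjoint_left]
    intro i hi hi'
    obtain ⟨a, -, rfl⟩ := Finset.mem_image.1 hi
    obtain ⟨b, -, hb⟩ := Finset.mem_image.1 hi'
    have hadj : (G.lexProd (completeGraph (Fin t))).Adj (x, a) (y, b) := .inr hxy
    exact C.valid hadj hb.symm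
  · intro i
    obtain ⟨⟨x, a⟩, rfl, hb⟩ := hC i
    refine ⟨x, hmem x a, fun j hj => ?_⟩
    obtain ⟨⟨y, b⟩, hadj, rfl⟩ := hb j (by rintro rfl; exact hj (hmem x a))
    rcases hadj with ⟨h, -⟩ | hxy
    · obtain rfl : x = y := h
      exact absurd (hmem x b) hj
    · exact ⟨y, hxy, hmem y b⟩

/-- `G[K_t]` has b-colorings with all numbers of colours between `ω(G) t` and `χ_b(G[K_t])`. -/
theorem HasSimplicialElimination.mem_bSpectrum_lexProd_completeGraph {V : Type*} [Finite V]
    [Nonempty V] {G : SimpleGraph V} (hG : G.HasSimplicialElimination) {t k : ℕ} (ht : 0 < t)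
    (hk : 0 < k) (hl : G.cliqueNum * t ≤ k)
    (hu : k ≤ (G.lexProd (completeGraph (Fin t))).bChromaticNumber) :
    k ∈ (G.lexProd (completeGraph (Fin t))).bSpectrum := by
  have := Fintype.ofFinite V
  have : Nonempty (Fin t) := ⟨⟨0, ht⟩⟩
  obtain ⟨-, C, hC⟩ := (G.lexProd (completeGraph (Fin t))).bChromaticNumber_mem_bSpectrum
  obtain ⟨K, c, rfl, hc⟩ := hG.lexProd_completeGraph.exists_isBColoringOn k Finset.univ _ _
    hC.isBColoringOn (fun Q _ hQ => hQ.card_le_of_lexProd_completeGraph.trans hl)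
    (by rwa [Finset.card_fin])
  exact hc.card_mem_bSpectrum hk

end SimpleGraph

/-! ### The two ranges combined -/

theorem mainTheorem6 {V W : Type*} [Finite V] [Nonempty V] [Finite W]
    (G : SimpleGraph V) (H : SimpleGraph W) (hG : G.IsChordal) (hH : H.IsBContinuous) :
    ∀ k : ℕ, (G.lexProd H).chromaticNumber ≤ (k : ℕ∞) →
      k ≤ (G.lexProd (SimpleGraph.completeGraph (Fin H.bChromaticNumber))).bChromaticNumber →
      k ∈ (G.lexProd H).bSpectrum := by
  intro k hk hkt
  have := hH.nonempty
  have hsimp := hG.hasSimplicialElimination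
  have hcol := SimpleGraph.chromaticNumber_le_iff_colorable.1 hk
  have hkpos : 0 < k := by
    obtain ⟨C⟩ := hcol
    exact Fin.pos (C (Classical.arbitrary (V × W)))
  obtain ⟨h, hh, hhS⟩ := H.exists_chromaticNumber_eq_mem_bSpectrum
  have htS := H.bChromaticNumber_mem_bSpectrum
  have hl := SimpleGraph.cliqueNum_mul_le_of_lexProd_colorable hh hcol
  rcases le_total k (G.cliqueNum * H.bChromaticNumber) with hle | hle
  · refine SimpleGraph.lexProd_mem_bSpectrum_of_le_mul hsimp.colorable_cliqueNum
      (SimpleGraph.le_bChromaticNumber hhS) (fun s hs hst => hH s ?_ hst) hkpos hl hle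
    rw [hh]
    exact Nat.cast_le.2 hs
  · exact SimpleGraph.lexProd_bSpectrum_subset htS
      (hsimp.mem_bSpectrum_lexProd_completeGraph htS.1 hkpos hle hkt)
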